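/- For $n\ge 0$ let $\Delta_n=\{(x_0,\dots,x_n)\in\mathbb{R}^{n+1}: x_k\ge 0,\ \sum_{k=0}^n x_k=1\}$ be the standard simplex, with vertices $e_0,\dots,e_n$. A function $h:\Delta_n\to\mathbb{R}$ is called approximately convex if $$h\Bigl(\frac{a+b}{2}\Bigr)\le\frac{h(a)+h(b)}{2}+1\qquad\text{for all } a,b\in\Delta_n .$$ Let $\{t\}=t-\lfloor t\rfloor$ denote the fractional part, and put $$H(t)=\sum_{k=0}^{\infty}\frac{\{2^k t\}}{2^k}\quad(t\in\mathbb{R}),\qquad E(x_0,\dots,x_n)=\sum_{k=0}^n H(x_k)\quad\text{on }\Delta_n .$$ Let $\kappa(0)=0$ and $\kappa(n)=\lfloor\log_2 n\rfloor+1+n/2^{\lfloor\log_2 n\rfloor}$ for $n\ge 1$. Then, for every $n \ge 0$: 1. $E$ is approximately convex, bounded and lower semicontinuous, and $E(e_k)=0$ for $0\le k\le n$. 2. If $h:\Delta_n\to\mathbb{R}$ is approximately convex, $h$ is bounded or Borel measurable, and $h(e_k)\le 0$ for $0\le k\le n$, then $h(x)\le E(x)$ for all $x\in\Delta_n$. 3.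 Property 2 characterizes $E$: let $F:\Delta_n\to\mathbb{R}$ be approximately convex, bounded or Borel measurable, with $F(e_k)\le 0$ for $0\le k\le n$. Suppose that $h\le F$ on $\Delta_n$ either for every bounded approximately convex $h:\Delta_n\to\mathbb{R}$ with $h(e_k)\le 0$ for all $k$, or for every Borel measurable such $h$. Then $F=E$. 4. $E$ attains its maximum, the maximum value is $\kappa(n)$, and $\{x\in\Delta_n:E(x)=\kappa(n)\}$ is a $G_\delta$ subset of $\Delta_n$, which is uncountable if $n\ge 1$. -/

import Mathlib

/-- The standard `n`-simplex, in affine coordinates `x 0, …, x n`. -/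
abbrev Simplex (n : ℕ) : Type := stdSimplex ℝ (Fin (n + 1))

/-- A real function `h` on a (convex) set `K` is approximately convex if
`h ((a + b) / 2) ≤ (h a + h b) / 2 + 1` for all `a, b ∈ K`. Here `c` is the midpoint of `a` and `b`
as an element of `K`; it exists when `K` is convex. -/
def ApproxConvex {X : Type*} [NormedAddCommGroup X] [NormedSpace ℝ X] {K : Set X}
    (h : K → ℝ) : Prop :=
  ∀ a b c : K, (c : X) = midpoint ℝ (a : X) (b : X) → h c ≤ (h a + h b) / 2 + 1

/-- `h` is a bounded function (above and below). -/
def BoundedFun {α : Type*} (h : α → ℝ) : Prop := ∃ C : ℝ, ∀ x, |h x| ≤ C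

/-- `F` dominates every bounded approximately convex function on the simplex that is
nonpositive at the vertices. -/
def DominatesBounded (n : ℕ) (F : Simplex n → ℝ) : Prop :=
  ∀ h : Simplex n → ℝ, BoundedFun h → ApproxConvex h → (∀ k, h (stdSimplex.vertex k) ≤ 0) →
    ∀ x, h x ≤ F x

/-- `F` dominates every Borel measurable approximately convex function on the simplex that is
nonpositive at the vertices. -/
def DominatesBorel (n : ℕ) (F : Simplex n → ℝ) : Prop :=
  ∀ h : Simplex n → ℝ, Measurable h → ApproxConvex h → (∀ k, h (stdSimplex.vertex k) ≤ 0) →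
    ∀ x, h x ≤ F x

/-- `H x = ∑_{k ≥ 0} {2^k x} / 2^k`, where `{·}` is the fractional part. -/
noncomputable def H (x : ℝ) : ℝ := ∑' k : ℕ, Int.fract (2 ^ k * x) / 2 ^ k

/-- The series that defines `H` converges for every real `x`. -/
theorem summable_H (x : ℝ) : Summable fun k : ℕ => Int.fract (2 ^ k * x) / (2 : ℝ) ^ k := by
  refine Summable.of_nonneg_of_le (fun k => by positivity) (fun k => ?_) summable_geometric_two
  rw [one_div, inv_pow, ← one_div]
  gcongr
  exact (Int.fract_lt_one _).le

/-- `E x = ∑_{k = 0}^n H (x_k)` on the standard `n`-simplex. -/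
noncomputable def E (n : ℕ) (x : Simplex n) : ℝ := ∑ k : Fin (n + 1), H ((x : Fin (n + 1) → ℝ) k)

/-- `κ 0 = 0` and `κ n = ⌊log₂ n⌋ + 1 + n / 2 ^ ⌊log₂ n⌋` for `n ≥ 1`
(`Nat.log 2 n` is the integer part of `log₂ n`). -/
noncomputable def kappa (n : ℕ) : ℝ :=
  if n = 0 then 0 else (Nat.log 2 n : ℝ) + 1 + (n : ℝ) / 2 ^ Nat.log 2 n

/-! Two facts drive the approximate convexity of `E`: `H` is subadditive, because the fractional
part is, and `H t = {t} + H (2t) / 2`. At a midpoint of `a` and `b` the first terms add up to at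
most 1, and the rest to at most the mean of `E a` and `E b`.

For the upper bound, let `r_k` be the vector of the `{2^k x_i}`. Its mass `N_k` is an integer, and
`E x = ∑ N_k / 2^k`. Doubling `r_k` gives `r_{k+1}` plus some vertices, `2 N_k` units of mass in
all. So a decomposition of `r_{k+1}` into `N_{k+1}` simplex points, joined by those vertices and
averaged in pairs, decomposes `r_k` into `N_k` points. Each averaging costs 1 and halves the earlier
total (`exists_list_residual`). Starting `j` levels deep with a crude bound `C` leaves an error `n C
/ 2^j`. Only an upper bound on `h` is used; for Borel `h` it comes from a Steinhaus-type argument on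
edges, then induction over faces. Since `E` lies in both classes, it is the only extremal function.

The maximum comes from `N_k ≤ min n (2^k)`. Equality for all `k` is arranged through binary digits,
with enough freedom to encode any 0-1 sequence. -/

theorem E_eq_sum (n : ℕ) (x : Simplex n) : E n x = ∑ k, H (x.1 k) := rfl

/-! ### Regularity and approximate convexity of `E` -/

theorem fract_le_self_of_nonneg {x : ℝ} (hx : 0 ≤ x) : Int.fract x ≤ x := by
  have : (0 : ℝ) ≤ ⌊x⌋ := by exact_mod_cast Int.floor_nonneg.2 hx
  rw [← Int.self_sub_floor]
  linarith

theorem fract_two_pow_div_nonneg (x : ℝ) (k : ℕ) : 0 ≤ Int.fract (2 ^ k * x) / (2 : ℝ) ^ k :=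
  div_nonneg (Int.fract_nonneg _) (by positivity)

theorem H_nonneg (x : ℝ) : 0 ≤ H x := tsum_nonneg fun k => fract_two_pow_div_nonneg x k

theorem H_le_two (x : ℝ) : H x ≤ 2 := by
  rw [← tsum_geometric_two]
  refine (summable_H x).tsum_le_tsum (fun k => ?_) summable_geometric_two
  rw [one_div, inv_pow, ← one_div]
  gcongr
  exact (Int.fract_lt_one _).le

theorem H_intCast (m : ℤ) : H m = 0 := by
  have h : ∀ k : ℕ, Int.fract (2 ^ k * (m : ℝ)) / (2 : ℝ) ^ k = 0 := fun k => by
    have : (2 ^ k * (m : ℝ)) = ((2 ^ k * m : ℤ) : ℝ) := by push_cast; rfl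
    rw [this, Int.fract_intCast, zero_div]
  simp [H, h]

theorem H_zero : H 0 = 0 := by simpa using H_intCast 0

theorem H_one : H 1 = 0 := by simpa using H_intCast 1

theorem H_add_le (x y : ℝ) : H (x + y) ≤ H x + H y := by
  unfold H
  rw [← (summable_H x).tsum_add (summable_H y)]
  refine (summable_H _).tsum_le_tsum (fun k => ?_) ((summable_H x).add (summable_H y))
  rw [← add_div, mul_add]
  gcongr
  exact Int.fract_add_le _ _

theorem H_eq_fract_add (x : ℝ) : H x = Int.fract x + H (2 * x) / 2 := by
  unfold H
  rw [(summable_H x).tsum_eq_zero_add, ← tsum_div_const]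
  congr 1
  · simp
  · refine tsum_congr fun k => ?_
    rw [pow_succ, ← mul_assoc, div_div]

/-- The only jumps are at integers, where the value 0 is the minimum. -/
theorem lowerSemicontinuous_fract : LowerSemicontinuous (Int.fract : ℝ → ℝ) := by
  intro x y hy
  by_cases h : y < 0
  · exact Filter.Eventually.of_forall fun z => h.trans_le (Int.fract_nonneg z)
  · have h1 : (⌊x⌋ : ℝ) + y < x := by
      have := Int.self_sub_floor x
      linarith
    filter_upwards [eventually_gt_nhds h1, eventually_lt_nhds (Int.lt_floor_add_one x)] with z hz hz'
    have : ⌊z⌋ = ⌊x⌋ := by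
      rw [Int.floor_eq_iff]
      exact ⟨by linarith, hz'⟩
    rw [← Int.self_sub_floor, this]
    linarith

theorem H_eq_iSup (x : ℝ) :
    H x = ⨆ N : ℕ, ∑ k ∈ Finset.range N, Int.fract (2 ^ k * x) / (2 : ℝ) ^ k := by
  refine ((isLUB_hasSum (fun k => fract_two_pow_div_nonneg x k)
    (summable_H x).hasSum).unique ?_).trans rfl
  have hbdd : BddAbove (Set.range fun N : ℕ =>
      ∑ k ∈ Finset.range N, Int.fract (2 ^ k * x) / (2 : ℝ) ^ k) :=
    ⟨H x, by
      rintro _ ⟨N, rfl⟩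
      exact (summable_H x).sum_le_tsum _ fun k _ => fract_two_pow_div_nonneg x k⟩
  refine ⟨?_, fun b hb => ciSup_le fun N => hb ⟨Finset.range N, rfl⟩⟩
  rintro _ ⟨s, rfl⟩
  obtain ⟨N, hN⟩ := s.exists_nat_subset_range
  exact (Finset.sum_le_sum_of_subset_of_nonneg hN
    fun k _ _ => fract_two_pow_div_nonneg x k).trans (le_ciSup hbdd N)

theorem lowerSemicontinuous_H : LowerSemicontinuous H := by
  rw [funext H_eq_iSup]
  refine lowerSemicontinuous_ciSup (fun x => ⟨H x, ?_⟩) fun N => lowerSemicontinuous_sum fun k _ => ?_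
  · rintro _ ⟨N, rfl⟩
    exact (summable_H x).sum_le_tsum _ fun k _ => fract_two_pow_div_nonneg x k
  · have h1 : LowerSemicontinuous fun x : ℝ => Int.fract (2 ^ k * x) :=
      lowerSemicontinuous_fract.comp (continuous_const.mul continuous_id)
    have h2 : Continuous fun y : ℝ => y / (2 : ℝ) ^ k := by fun_prop
    exact h2.comp_lowerSemicontinuous h1 fun a b hab => by simp only; gcongr

theorem lowerSemicontinuous_E (n : ℕ) : LowerSemicontinuous (E n) := by
  have h : E n = fun x : Simplex n => ∑ k, H (x.1 k) := funext fun x => E_eq_sum n x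
  rw [h]
  exact lowerSemicontinuous_sum fun k _ =>
    lowerSemicontinuous_H.comp ((continuous_apply k).comp continuous_subtype_val)

theorem E_nonneg (n : ℕ) (x : Simplex n) : 0 ≤ E n x := Finset.sum_nonneg fun _ _ => H_nonneg _

theorem boundedFun_E (n : ℕ) : BoundedFun (E n) := by
  refine ⟨(n + 1) * 2, fun x => ?_⟩
  rw [abs_of_nonneg (E_nonneg n x), E_eq_sum]
  refine (Finset.sum_le_sum fun k _ => H_le_two (x.1 k)).trans (by simp)

theorem vertex_val (n : ℕ) (k i : Fin (n + 1)) :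
    (stdSimplex.vertex k : Simplex n).1 i = if i = k then 1 else 0 := by
  change (Pi.single k 1 : Fin (n + 1) → ℝ) i = _
  rw [Pi.single_apply]

theorem E_vertex (n : ℕ) (k : Fin (n + 1)) : E n (stdSimplex.vertex k) = 0 := by
  rw [E_eq_sum]
  refine Finset.sum_eq_zero fun i _ => ?_
  rw [vertex_val]
  split_ifs
  · exact H_one
  · exact H_zero

theorem simplex_nonneg {n : ℕ} (x : Simplex n) (i : Fin (n + 1)) : 0 ≤ x.1 i := x.2.1 i

theorem simplex_sum {n : ℕ} (x : Simplex n) : ∑ i, x.1 i = 1 := x.2.2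

theorem simplex_le_one {n : ℕ} (x : Simplex n) (i : Fin (n + 1)) : x.1 i ≤ 1 := by
  rw [← simplex_sum x]
  exact Finset.single_le_sum (fun j _ => simplex_nonneg x j) (Finset.mem_univ i)

theorem simplex_add_le_one {n : ℕ} (x : Simplex n) {i j : Fin (n + 1)} (hij : i ≠ j) :
    x.1 i + x.1 j ≤ 1 := by
  rw [← simplex_sum x, ← Finset.sum_pair hij]
  exact Finset.sum_le_sum_of_subset_of_nonneg (Finset.subset_univ _)
    fun k _ _ => simplex_nonneg x k

theorem eq_vertex_of_eq_one {n : ℕ} {x : Simplex n} {i : Fin (n + 1)} (h : x.1 i = 1) :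
    x = stdSimplex.vertex i := by
  refine Subtype.ext (funext fun j => ?_)
  rw [vertex_val]
  split_ifs with hj
  · rw [hj, h]
  · have := simplex_add_le_one x hj
    linarith [simplex_nonneg x j]

theorem midpoint_apply_eq {ι : Type*} (a b : ι → ℝ) (i : ι) : midpoint ℝ a b i = (a i + b i) / 2 := by
  rw [midpoint_eq_smul_add]
  simp
  ring

theorem approxConvex_E (n : ℕ) : ApproxConvex (E n) := by
  intro a b c hc
  have hc' : ∀ i, 2 * c.1 i = a.1 i + b.1 i := fun i => by
    have : c.1 i = (a.1 i + b.1 i) / 2 := by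
      rw [← midpoint_apply_eq]; exact congrFun hc i
    linarith
  have h1 : ∑ i, Int.fract (c.1 i) ≤ 1 := by
    rw [← simplex_sum c]
    exact Finset.sum_le_sum fun i _ => fract_le_self_of_nonneg (simplex_nonneg c i)
  have h2 : ∑ i, H (2 * c.1 i) ≤ ∑ i, H (a.1 i) + ∑ i, H (b.1 i) := by
    rw [← Finset.sum_add_distrib]
    exact Finset.sum_le_sum fun i _ => hc' i ▸ H_add_le _ _
  rw [E_eq_sum n c, Finset.sum_congr rfl fun i _ => H_eq_fract_add (c.1 i),
    Finset.sum_add_distrib, ← Finset.sum_div, E_eq_sum, E_eq_sum]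
  linarith

/-! ### Extremality of `E` among functions bounded above -/

theorem exists_list_halved {X : Type*} [NormedAddCommGroup X] [NormedSpace ℝ X] {K : Set X}
    (hK : Convex ℝ K) {h : K → ℝ} (hh : ApproxConvex h) :
    ∀ (N : ℕ) (L : List K), L.length = 2 * N → ∃ L' : List K, L'.length = N ∧
      (2 : ℝ) • (L'.map Subtype.val).sum = (L.map Subtype.val).sum ∧
      (L'.map h).sum ≤ (L.map h).sum / 2 + N
  | 0, L, hL => ⟨[], rfl, by simp_all, by simp_all⟩
  | N + 1, [], hL => by simp at hL
  | N + 1, [a], hL => by simp at hL; omega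
  | N + 1, a :: b :: L, hL => by
    obtain ⟨L', h1, h2, h3⟩ := exists_list_halved hK hh N L (by simp at hL; omega)
    have hc : midpoint ℝ (a : X) (b : X) ∈ K := hK.midpoint_mem a.2 b.2
    refine ⟨⟨_, hc⟩ :: L', by simp [h1], ?_, ?_⟩
    · simp only [List.map_cons, List.sum_cons, smul_add, h2]
      rw [midpoint_eq_smul_add, smul_smul]
      simp [add_assoc]
    · have := hh a b ⟨_, hc⟩ rfl
      simp only [List.map_cons, List.sum_cons]
      push_cast
      linarith

/-- The integer `∑ i, {2 ^ k x i}`. -/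
noncomputable def fractMass {n : ℕ} (x : Simplex n) (k : ℕ) : ℕ :=
  ⌊∑ i, Int.fract (2 ^ k * x.1 i)⌋₊

/-- The coordinates of `2^k x` add up to the integer `2^k`, so removing their integer parts leaves
an integer and the floor loses nothing. -/
theorem fractMass_eq {n : ℕ} (x : Simplex n) (k : ℕ) :
    (fractMass x k : ℝ) = ∑ i, Int.fract (2 ^ k * x.1 i) := by
  have h : ∑ i, Int.fract (2 ^ k * x.1 i) = ((2 ^ k - ∑ i, ⌊2 ^ k * x.1 i⌋ : ℤ) : ℝ) := by
    push_cast
    simp_rw [← Int.self_sub_floor]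
    rw [Finset.sum_sub_distrib, ← Finset.mul_sum, simplex_sum, mul_one]
  have h0 : 0 ≤ ∑ i, Int.fract (2 ^ k * x.1 i) := Finset.sum_nonneg fun i _ => Int.fract_nonneg _
  unfold fractMass
  rw [h] at h0 ⊢
  rw [natCast_floor_eq_intCast_floor h0, Int.floor_intCast]

theorem fractMass_le {n : ℕ} (x : Simplex n) (k : ℕ) : fractMass x k ≤ n := by
  have h : (fractMass x k : ℝ) < n + 1 := by
    rw [fractMass_eq]
    refine (Finset.sum_lt_sum_of_nonempty Finset.univ_nonempty
      fun i _ => Int.fract_lt_one (2 ^ k * x.1 i)).trans_eq (by simp)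
  have : fractMass x k < n + 1 := by exact_mod_cast h
  omega

theorem fractMass_le_two_pow {n : ℕ} (x : Simplex n) (k : ℕ) : fractMass x k ≤ 2 ^ k := by
  have h : (fractMass x k : ℝ) ≤ 2 ^ k := by
    rw [fractMass_eq]
    calc ∑ i, Int.fract (2 ^ k * x.1 i) ≤ ∑ i, 2 ^ k * x.1 i :=
          Finset.sum_le_sum fun i _ =>
            fract_le_self_of_nonneg (mul_nonneg (by positivity) (simplex_nonneg x i))
      _ = 2 ^ k := by rw [← Finset.mul_sum, simplex_sum, mul_one]
  exact_mod_cast h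

theorem hasSum_E {n : ℕ} (x : Simplex n) :
    HasSum (fun k => (fractMass x k : ℝ) / 2 ^ k) (E n x) := by
  rw [E_eq_sum]
  have := hasSum_sum (s := Finset.univ) fun (i : Fin (n + 1)) _ => (summable_H (x.1 i)).hasSum
  refine this.congr_fun fun k => ?_
  rw [fractMass_eq, Finset.sum_div]

theorem fract_two_mul (u : ℝ) :
    Int.fract (2 * u) = 2 * Int.fract u - if 1 / 2 ≤ Int.fract u then 1 else 0 := by
  rw [Int.fract_eq_iff]
  have h0 := Int.fract_nonneg u
  have h1 := Int.fract_lt_one u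
  have h2 := Int.self_sub_floor u
  split_ifs with h
  · exact ⟨by linarith, by linarith, 2 * ⌊u⌋ + 1, by push_cast; linarith⟩
  · exact ⟨by linarith, by linarith, 2 * ⌊u⌋, by push_cast; linarith⟩

theorem exists_list_sum_eq_smul {X : Type*} [NormedAddCommGroup X] [NormedSpace ℝ X] {K : Set X}
    (h : K → ℝ) {C : ℝ} (hC : ∀ y, h y ≤ C) (y : K) (N : ℕ) :
    ∃ L : List K, L.length = N ∧ (L.map Subtype.val).sum = (N : ℝ) • (y : X) ∧
      (L.map h).sum ≤ N * C := by
  refine ⟨List.replicate N y, by simp, by simp [Nat.cast_smul_eq_nsmul], ?_⟩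
  simp only [List.map_replicate, List.sum_replicate, nsmul_eq_mul]
  exact mul_le_mul_of_nonneg_left (hC y) (by positivity)

/-- Induction on the depth `j`, passing from level `k + 1` back to level `k`; the added vertices
contribute nothing positive to the total of `h`. -/
theorem exists_list_residual {n : ℕ} {h : Simplex n → ℝ} (hh : ApproxConvex h)
    (hv : ∀ k, h (stdSimplex.vertex k) ≤ 0) {C : ℝ} (hC0 : 0 ≤ C) (hC : ∀ y, h y ≤ C)
    (x : Simplex n) : ∀ j k : ℕ, ∃ L : List (Simplex n), L.length = fractMass x k ∧
      (L.map Subtype.val).sum = (fun i => Int.fract (2 ^ k * x.1 i)) ∧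
      (L.map h).sum ≤ (∑ l ∈ Finset.range j, (fractMass x (k + l) : ℝ) / 2 ^ l) + n * C / 2 ^ j
  | 0, k => by
    have hN : (fractMass x k : ℝ) * C ≤ n * C :=
      mul_le_mul_of_nonneg_right (by exact_mod_cast fractMass_le x k) hC0
    by_cases h0 : fractMass x k = 0
    · refine ⟨[], by simp [h0], ?_, by simp; positivity⟩
      have := fractMass_eq x k
      rw [h0, Nat.cast_zero, eq_comm,
        Finset.sum_eq_zero_iff_of_nonneg fun i _ => Int.fract_nonneg _] at this
      funext i
      simpa using (this i (Finset.mem_univ i)).symm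
    · have hpos : (fractMass x k : ℝ) ≠ 0 := by exact_mod_cast h0
      -- The crude start: the residual vector is `fractMass x k` copies of its normalization.
      let y : Simplex n := ⟨fun i => Int.fract (2 ^ k * x.1 i) / fractMass x k,
        fun i => div_nonneg (Int.fract_nonneg _) (by positivity), by
          rw [← Finset.sum_div, ← fractMass_eq, div_self hpos]⟩
      obtain ⟨L, h1, h2, h3⟩ := exists_list_sum_eq_smul h hC y (fractMass x k)
      refine ⟨L, h1, ?_, by simpa using h3.trans hN⟩
      rw [h2]
      funext i
      exact mul_div_cancel₀ _ hpos
  | j + 1, k => by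
    obtain ⟨L, h1, h2, h3⟩ := exists_list_residual hh hv hC0 hC x j (k + 1)
    -- `S` records the coordinates that carry a unit when doubled; each yields one vertex.
    set S := Finset.univ.filter fun i => 1 / 2 ≤ Int.fract (2 ^ k * x.1 i) with hS
    have hfr : ∀ i, Int.fract (2 ^ (k + 1) * x.1 i) =
        2 * Int.fract (2 ^ k * x.1 i) - if i ∈ S then 1 else 0 := fun i => by
      rw [pow_succ', mul_assoc, fract_two_mul]
      simp [hS]
    have hcard : fractMass x (k + 1) + S.card = 2 * fractMass x k := by
      have : (fractMass x (k + 1) : ℝ) + S.card = 2 * fractMass x k := by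
        rw [fractMass_eq, fractMass_eq, Finset.sum_congr rfl fun i _ => hfr i,
          Finset.sum_sub_distrib, ← Finset.mul_sum]
        simp
      exact_mod_cast this
    obtain ⟨L', g1, g2, g3⟩ := exists_list_halved (convex_stdSimplex ℝ _) hh (fractMass x k)
      (L ++ S.toList.map stdSimplex.vertex) (by simp [h1, hcard])
    refine ⟨L', g1, ?_, ?_⟩
    · have hsum : ∀ i, ((S.toList.map (stdSimplex.vertex : Fin (n + 1) → Simplex n)).map
          Subtype.val).sum i = if i ∈ S then 1 else 0 := fun i => by
        rw [List.map_map, Finset.sum_map_toList, Finset.sum_apply]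
        simp
      funext i
      have := congrFun g2 i
      rw [List.map_append, List.sum_append, Pi.add_apply, h2, hsum] at this
      simp only [hfr, Pi.smul_apply, smul_eq_mul] at this
      linarith
    · have hneg : ((S.toList.map (stdSimplex.vertex : Fin (n + 1) → Simplex n)).map h).sum ≤ 0 := by
        rw [List.map_map, Finset.sum_map_toList]
        exact Finset.sum_nonpos fun i _ => hv i
      rw [List.map_append, List.sum_append] at g3
      rw [Finset.sum_range_succ', pow_succ, ← div_div]
      have : ∑ l ∈ Finset.range j, (fractMass x (k + (l + 1)) : ℝ) / 2 ^ (l + 1) =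
          (∑ l ∈ Finset.range j, (fractMass x (k + 1 + l) : ℝ) / 2 ^ l) / 2 := by
        rw [Finset.sum_div]
        refine Finset.sum_congr rfl fun l _ => ?_
        rw [pow_succ, div_div, add_right_comm, add_assoc]
      rw [this]
      simp only [add_zero, pow_zero, div_one]
      linarith

theorem le_E_of_bounded_above {n : ℕ} {h : Simplex n → ℝ} (hh : ApproxConvex h)
    (hv : ∀ k, h (stdSimplex.vertex k) ≤ 0) {C : ℝ} (hC : ∀ y, h y ≤ C) (x : Simplex n) :
    h x ≤ E n x := by
  -- At a vertex the level 0 residual vanishes instead of being `x`.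
  by_cases hx : ∃ i, x.1 i = 1
  · obtain ⟨i, hi⟩ := hx
    rw [eq_vertex_of_eq_one hi, E_vertex]
    exact hv i
  push Not at hx
  have hfr : ∀ i, Int.fract (2 ^ 0 * x.1 i) = x.1 i := fun i => by
    rw [pow_zero, one_mul, Int.fract_eq_self]
    exact ⟨simplex_nonneg x i, lt_of_le_of_ne (simplex_le_one x i) (hx i)⟩
  have h0 : fractMass x 0 = 1 := by
    have := fractMass_eq x 0
    rw [Finset.sum_congr rfl fun i _ => hfr i, simplex_sum] at this
    exact_mod_cast this
  have key : ∀ j : ℕ, h x ≤ E n x + n * max C 0 / 2 ^ j := fun j => by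
    obtain ⟨L, h1, h2, h3⟩ := exists_list_residual hh hv (le_max_right C 0)
      (fun y => (hC y).trans (le_max_left C 0)) x j 0
    rw [h0, List.length_eq_one_iff] at h1
    obtain ⟨q, rfl⟩ := h1
    simp only [hfr, List.map_cons, List.map_nil, List.sum_cons, List.sum_nil, add_zero,
      zero_add] at h2 h3
    have hq : q = x := Subtype.ext h2
    rw [hq] at h3
    have := sum_le_hasSum (Finset.range j) (fun k _ => by positivity) (hasSum_E x)
    linarith
  have hlim : Filter.Tendsto (fun j : ℕ => E n x + n * max C 0 / (2 : ℝ) ^ j) Filter.atTop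
      (nhds (E n x + 0)) :=
    tendsto_const_nhds.add (tendsto_const_nhds.div_atTop
      (tendsto_pow_atTop_atTop_of_one_lt one_lt_two))
  rw [add_zero] at hlim
  exact ge_of_tendsto' hlim key

/-! ### Borel measurable approximately convex functions are bounded above -/

open MeasureTheory in
theorem exists_volume_superlevel_lt {g : ℝ → ℝ} (hg : Measurable g) {ε : ENNReal} (hε : 0 < ε) :
    ∃ M : ℕ, volume (Set.Icc (0 : ℝ) 1 ∩ {t | (M : ℝ) < g t}) < ε := by
  have hlim : Filter.Tendsto (fun M : ℕ => volume (Set.Icc (0 : ℝ) 1 ∩ {t | (M : ℝ) < g t}))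
      Filter.atTop (nhds (volume (⋂ M : ℕ, Set.Icc (0 : ℝ) 1 ∩ {t | (M : ℝ) < g t}))) := by
    refine tendsto_measure_iInter_atTop
      (fun M => (measurableSet_Icc.inter (measurableSet_lt measurable_const hg)).nullMeasurableSet)
      (fun M N hMN t ht => ⟨ht.1, (Nat.cast_le.2 hMN : (M : ℝ) ≤ N).trans_lt ht.2⟩)
      ⟨0, ne_top_of_le_ne_top ?_ (measure_mono Set.inter_subset_left)⟩
    simp
  -- The decreasing superlevel sets have empty intersection because `g` is finite everywhere.
  have hempty : (⋂ M : ℕ, Set.Icc (0 : ℝ) 1 ∩ {t | (M : ℝ) < g t}) = ∅ := by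
    refine Set.eq_empty_of_forall_notMem fun t ht => ?_
    obtain ⟨M, hM⟩ := exists_nat_gt (g t)
    exact lt_asymm hM (Set.mem_iInter.1 ht M).2
  rw [hempty, measure_empty] at hlim
  exact (hlim.eventually (gt_mem_nhds hε)).exists

-- If `g x > M + 1`, then for every `t` in `[0, 1/4]` one of `x - t`, `x + t` lies in the superlevel
-- set `A`. Hence `1/4 ≤ 2 |A| < 1/4`, a contradiction.
open MeasureTheory in
theorem le_of_volume_superlevel_lt {g : ℝ → ℝ} {M : ℝ}
    (hM : volume (Set.Icc (0 : ℝ) 1 ∩ {t | M < g t}) < ENNReal.ofReal (1 / 8))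
    (hmid : ∀ a ∈ Set.Icc (0 : ℝ) 1, ∀ b ∈ Set.Icc (0 : ℝ) 1,
      g ((a + b) / 2) ≤ (g a + g b) / 2 + 1)
    {x : ℝ} (hx : x ∈ Set.Icc (1 / 4 : ℝ) (3 / 4)) : g x ≤ M + 1 := by
  by_contra hcon
  set A := Set.Icc (0 : ℝ) 1 ∩ {t | M < g t} with hA
  have hsub : Set.Icc (0 : ℝ) (1 / 4) ⊆ (fun t => x - t) ⁻¹' A ∪ (fun t => x + t) ⁻¹' A := by
    intro t ht
    by_contra hnot
    rw [Set.mem_union, not_or] at hnot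
    have h1 : x - t ∈ Set.Icc (0 : ℝ) 1 := ⟨by linarith [hx.1, ht.2], by linarith [hx.2, ht.1]⟩
    have h2 : x + t ∈ Set.Icc (0 : ℝ) 1 := ⟨by linarith [hx.1, ht.1], by linarith [hx.2, ht.2]⟩
    have h3 : g (x - t) ≤ M := not_lt.1 fun h => hnot.1 ⟨h1, h⟩
    have h4 : g (x + t) ≤ M := not_lt.1 fun h => hnot.2 ⟨h2, h⟩
    have h5 := hmid _ h1 _ h2
    rw [show (x - t + (x + t)) / 2 = x by ring] at h5
    linarith
  have hle := (measure_mono (μ := volume) hsub).trans (measure_union_le _ _)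
  have e1 : volume ((fun t => x - t) ⁻¹' A) = volume A := by
    have : (fun t => x - t) ⁻¹' A = Neg.neg ⁻¹' ((fun t => x + t) ⁻¹' A) := by
      ext t
      simp [sub_eq_add_neg]
    rw [this, Measure.measure_preimage_neg, measure_preimage_add]
  rw [e1, measure_preimage_add, Real.volume_Icc] at hle
  have := hle.trans_lt (ENNReal.add_lt_add hM hM)
  rw [← ENNReal.ofReal_add (by norm_num) (by norm_num)] at this
  norm_num at this

/-- Since `x` is the midpoint of `0` and `2x`, the bound `M + 2` reproduces itself: `(M + (M + 2)) /
2 + 1 = M + 2`. So it does not deteriorate near 0. -/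
theorem le_of_doubling {g : ℝ → ℝ} {M : ℝ} (h0 : g 0 ≤ M)
    (hmid : ∀ a ∈ Set.Icc (0 : ℝ) 1, ∀ b ∈ Set.Icc (0 : ℝ) 1,
      g ((a + b) / 2) ≤ (g a + g b) / 2 + 1)
    (hM : ∀ x ∈ Set.Icc (1 / 4 : ℝ) (3 / 4), g x ≤ M + 1) :
    ∀ (j : ℕ) (x : ℝ), 1 / 4 ≤ 2 ^ j * x → x ≤ 3 / 4 → g x ≤ M + 2
  | 0, x, hx, hx' => by linarith [hM x ⟨by simpa using hx, hx'⟩]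
  | j + 1, x, hx, hx' => by
    by_cases h : 1 / 4 ≤ x
    · linarith [hM x ⟨h, hx'⟩]
    · have hx0 : 0 ≤ x := by
        by_contra hneg
        have : 2 ^ (j + 1) * x ≤ 0 :=
          mul_nonpos_of_nonneg_of_nonpos (by positivity) (not_le.1 hneg).le
        linarith
      have h1 := le_of_doubling h0 hmid hM j (2 * x) (by rwa [← mul_assoc, ← pow_succ])
        (by linarith)
      have h2 := hmid 0 ⟨le_rfl, zero_le_one⟩ (2 * x) ⟨by linarith, by linarith⟩
      rw [show (0 + 2 * x) / 2 = x by ring] at h2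
      linarith

theorem exists_bound_Icc_of_measurable {g : ℝ → ℝ} (hg : Measurable g)
    (hmid : ∀ a ∈ Set.Icc (0 : ℝ) 1, ∀ b ∈ Set.Icc (0 : ℝ) 1,
      g ((a + b) / 2) ≤ (g a + g b) / 2 + 1) :
    ∃ C, ∀ t ∈ Set.Icc (0 : ℝ) 1, g t ≤ C := by
  obtain ⟨M₀, hM₀⟩ := exists_volume_superlevel_lt hg
    (ENNReal.ofReal_pos.2 (by norm_num : (0 : ℝ) < 1 / 8))
  have hmiddle := fun x hx => le_of_volume_superlevel_lt (x := x) hM₀ hmid hx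
  set M : ℝ := max M₀ (max (g 0) (g 1)) with hMdef
  have hM : (M₀ : ℝ) ≤ M := le_max_left _ _
  have h0 : g 0 ≤ M := (le_max_left _ _).trans (le_max_right _ _)
  have h1 : g 1 ≤ M := (le_max_right _ _).trans (le_max_right _ _)
  have hpow : ∀ x : ℝ, 0 < x → ∃ j : ℕ, 1 / 4 ≤ 2 ^ j * x := fun x hx => by
    obtain ⟨j, hj⟩ := pow_unbounded_of_one_lt (1 / 4 / x) (one_lt_two : (1 : ℝ) < 2)
    exact ⟨j, ((div_lt_iff₀ hx).1 hj).le⟩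
  refine ⟨M + 2, fun t ht => ?_⟩
  by_cases htt : t ≤ 3 / 4
  · rcases ht.1.eq_or_lt with rfl | htpos
    · linarith
    · obtain ⟨j, hj⟩ := hpow t htpos
      exact le_of_doubling h0 hmid (fun x hx => (hmiddle x hx).trans (by linarith)) j t hj htt
  · rcases ht.2.eq_or_lt with rfl | htlt
    · linarith
    · obtain ⟨j, hj⟩ := hpow (1 - t) (by linarith)
      -- Points near 1 are handled by reflection.
      have := le_of_doubling (g := fun s => g (1 - s)) (M := M) (by simpa using h1)
        (fun a ha b hb => by
          have := hmid (1 - a) ⟨by linarith [ha.2], by linarith [ha.1]⟩ (1 - b)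
            ⟨by linarith [hb.2], by linarith [hb.1]⟩
          rwa [show (1 - a + (1 - b)) / 2 = 1 - (a + b) / 2 by ring] at this)
        (fun x hx => (hmiddle (1 - x) ⟨by linarith [hx.2], by linarith [hx.1]⟩).trans
          (by linarith)) j (1 - t) hj (by linarith)
      simpa using this

/-- The point `(1 - t) e_i + t e_j`, with `t` clamped to `[0, 1]`. -/
noncomputable def edgePoint {n : ℕ} (i j : Fin (n + 1)) (t : ℝ) : Simplex n :=
  ⟨AffineMap.lineMap (Pi.single i 1 : Fin (n + 1) → ℝ) (Pi.single j 1)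
      ((Set.projIcc (0 : ℝ) 1 zero_le_one t : ℝ)),
    (convex_stdSimplex ℝ _).lineMap_mem (single_mem_stdSimplex ℝ i) (single_mem_stdSimplex ℝ j)
      (Set.projIcc (0 : ℝ) 1 zero_le_one t).2⟩

theorem continuous_edgePoint {n : ℕ} (i j : Fin (n + 1)) : Continuous (edgePoint i j) :=
  (AffineMap.lineMap_continuous.comp
    (continuous_subtype_val.comp continuous_projIcc)).subtype_mk _

theorem edgePoint_val {n : ℕ} (i j : Fin (n + 1)) {t : ℝ} (ht : t ∈ Set.Icc (0 : ℝ) 1) :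
    (edgePoint i j t).1 = AffineMap.lineMap (Pi.single i 1 : Fin (n + 1) → ℝ) (Pi.single j 1) t := by
  simp [edgePoint, Set.projIcc_of_mem _ ht]

theorem exists_bound_edge {n : ℕ} {h : Simplex n → ℝ} (hh : ApproxConvex h) (hm : Measurable h)
    (i j : Fin (n + 1)) :
    ∃ C, ∀ x : Simplex n, (∀ k, k ≠ i → k ≠ j → x.1 k = 0) → h x ≤ C := by
  obtain ⟨C, hC⟩ := exists_bound_Icc_of_measurable
    (g := fun t => h (edgePoint i j t)) (hm.comp (continuous_edgePoint i j).measurable)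
    (fun a ha b hb => hh _ _ _ (by
      rw [edgePoint_val i j ha, edgePoint_val i j hb, edgePoint_val i j
        ⟨by linarith [ha.1, hb.1], by linarith [ha.2, hb.2]⟩, ← AffineMap.map_midpoint,
        midpoint_eq_smul_add, smul_eq_mul, invOf_eq_inv, inv_mul_eq_div]))
  refine ⟨C, fun x hx => ?_⟩
  have hxe : x = edgePoint i j (x.1 j) := by
    refine Subtype.ext ?_
    rw [edgePoint_val i j ⟨simplex_nonneg x j, simplex_le_one x j⟩]
    by_cases hij : i = j
    · subst hij
      have h1 : x.1 i = 1 := by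
        rw [← simplex_sum x]
        exact (Finset.sum_eq_single i (fun k _ hk => hx k hk hk) (by simp)).symm
      rw [eq_vertex_of_eq_one h1, AffineMap.lineMap_same]
      rfl
    · have h1 : x.1 i + x.1 j = 1 := by
        rw [← simplex_sum x, ← Finset.sum_pair hij]
        refine Finset.sum_subset (Finset.subset_univ _) fun k _ hk => ?_
        simp only [Finset.mem_insert, Finset.mem_singleton, not_or] at hk
        exact hx k hk.1 hk.2
      funext k
      rw [AffineMap.lineMap_apply_module, Pi.add_apply, Pi.smul_apply, Pi.smul_apply,
        Pi.single_apply, Pi.single_apply]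
      by_cases hki : k = i
      · subst hki
        simp [hij]
        linarith
      · by_cases hkj : k = j
        · subst hkj
          simp [hki]
        · simp [hki, hkj, hx k hki hkj]
  rw [hxe]
  exact hC _ ⟨simplex_nonneg x j, simplex_le_one x j⟩

theorem exists_two_le_half {n : ℕ} (x : Simplex n) {T : Finset (Fin (n + 1))} (hT : 2 < T.card) :
    ∃ j ∈ T, ∃ l ∈ T, j ≠ l ∧ x.1 j ≤ 1 / 2 ∧ x.1 l ≤ 1 / 2 := by
  obtain ⟨a, ha, b, hb, c, hc, hab, hac, hbc⟩ := Finset.two_lt_card.1 hT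
  have h1 := simplex_add_le_one x hab
  have h2 := simplex_add_le_one x hac
  have h3 := simplex_add_le_one x hbc
  by_cases h : x.1 a ≤ 1 / 2
  · by_cases h' : x.1 b ≤ 1 / 2
    · exact ⟨a, ha, b, hb, hab, h, h'⟩
    · exact ⟨a, ha, c, hc, hac, h, by linarith⟩
  · exact ⟨b, hb, c, hc, hbc, by linarith, by linarith⟩

/-- Split `2x` into `a + b`: all of coordinate `j` goes to `a`, all of `l` to `b`, and the rest is
shared in the ratio `θ : 1 - θ` that gives both mass 1. -/
theorem exists_midpoint_of_le_half {n : ℕ} (x : Simplex n) {j l : Fin (n + 1)} (hjl : j ≠ l)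
    (hj : x.1 j ≤ 1 / 2) (hl : x.1 l ≤ 1 / 2) :
    ∃ a b : Simplex n, (x : Fin (n + 1) → ℝ) = midpoint ℝ a.1 b.1 ∧ a.1 l = 0 ∧ b.1 j = 0 ∧
      ∀ k, x.1 k = 0 → a.1 k = 0 ∧ b.1 k = 0 := by
  have key : ∃ θ : ℝ, 0 ≤ θ ∧ θ ≤ 1 ∧ θ * (2 - 2 * x.1 j - 2 * x.1 l) = 1 - 2 * x.1 j := by
    rcases (by linarith : 0 ≤ 2 - 2 * x.1 j - 2 * x.1 l).eq_or_lt with h | h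
    · exact ⟨0, le_rfl, zero_le_one, by linarith⟩
    · exact ⟨(1 - 2 * x.1 j) / (2 - 2 * x.1 j - 2 * x.1 l), div_nonneg (by linarith) h.le,
        (div_le_one h).2 (by linarith), div_mul_cancel₀ _ h.ne'⟩
  obtain ⟨θ, h0, h1, hθ⟩ := key
  have hsum : ∀ (p q r : ℝ),
      ∑ k, (if k = j then p else if k = l then q else r * (2 * x.1 k)) =
        p + q + r * (2 - 2 * x.1 j - 2 * x.1 l) := fun p q r => by
    have e : ∀ k, (if k = j then p else if k = l then q else r * (2 * x.1 k)) =
        2 * r * x.1 k + (if k = j then p - r * (2 * x.1 j) else 0) +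
          (if k = l then q - r * (2 * x.1 l) else 0) := fun k => by
      by_cases hkj : k = j
      · subst hkj
        simp [hjl]
        ring
      · by_cases hkl : k = l
        · subst hkl
          simp [hkj]
          ring
        · simp [hkj, hkl]
          ring
    rw [Finset.sum_congr rfl fun k _ => e k, Finset.sum_add_distrib, Finset.sum_add_distrib,
      ← Finset.mul_sum, simplex_sum]
    simp
    ring
  refine ⟨⟨fun k => if k = j then 2 * x.1 j else if k = l then 0 else θ * (2 * x.1 k), ?_, ?_⟩,
    ⟨fun k => if k = j then 0 else if k = l then 2 * x.1 l else (1 - θ) * (2 * x.1 k), ?_, ?_⟩,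
    ?_, ?_, ?_, ?_⟩
  · intro k
    have := simplex_nonneg x k
    have := simplex_nonneg x j
    dsimp only
    split_ifs <;> positivity
  · rw [hsum, hθ]
    ring
  · intro k
    have := simplex_nonneg x k
    have := simplex_nonneg x l
    have : 0 ≤ 1 - θ := by linarith
    dsimp only
    split_ifs <;> positivity
  · rw [hsum]
    linarith
  · funext k
    change x.1 k = _
    rw [midpoint_apply_eq]
    dsimp only
    by_cases hkj : k = j
    · subst hkj
      simp
    · by_cases hkl : k = l
      · subst hkl
        simp [hkj]
      · simp [hkj, hkl]
        ring
  · simp [hjl.symm]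
  · simp
  · intro k hk
    dsimp only
    constructor
    · split_ifs with e1
      · rw [← e1, hk, mul_zero]
      · rfl
      · rw [hk, mul_zero, mul_zero]
    · split_ifs with e1 e2
      · rfl
      · rw [← e2, hk, mul_zero]
      · rw [hk, mul_zero, mul_zero]

/-- A point of a face with at least three vertices is a midpoint of points in two smaller faces, so
each extra vertex costs at most 1. -/
theorem exists_bound_face {n : ℕ} {h : Simplex n → ℝ} (hh : ApproxConvex h)
    {C : ℝ} (hC : ∀ i j, ∀ x : Simplex n, (∀ k, k ≠ i → k ≠ j → x.1 k = 0) → h x ≤ C) :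
    ∀ (m : ℕ) (T : Finset (Fin (n + 1))), T.card ≤ m + 2 →
      ∀ x : Simplex n, (∀ k ∉ T, x.1 k = 0) → h x ≤ C + m
  | 0, T, hT, x, hx => by
    have hT' : ∃ i j, T ⊆ {i, j} := by
      rcases T.card.lt_or_ge 2 with h | h
      · have := Finset.card_le_one_iff_subset_singleton.1 (by omega : T.card ≤ 1)
        obtain ⟨i, hi⟩ := this
        exact ⟨i, i, hi.trans (by simp)⟩
      · obtain ⟨i, j, -, hij⟩ := Finset.card_eq_two.1 (le_antisymm hT h)
        exact ⟨i, j, hij.le⟩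
    obtain ⟨i, j, hij⟩ := hT'
    have := hC i j x fun k hki hkj => hx k fun hk => by
      have := hij hk
      simp [hki, hkj] at this
    simpa using this
  | m + 1, T, hT, x, hx => by
    by_cases h2 : T.card ≤ 2
    · have := exists_bound_face hh hC m T (by omega) x hx
      push_cast
      linarith
    obtain ⟨j, hjT, l, hlT, hjl, hj, hl⟩ := exists_two_le_half x (not_le.1 h2)
    obtain ⟨a, b, hab, hal, hbj, h0⟩ := exists_midpoint_of_le_half x hjl hj hl
    have hsupp : ∀ (i : Fin (n + 1)) (y : Simplex n), y.1 i = 0 → (∀ k, x.1 k = 0 → y.1 k = 0) →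
        ∀ k ∉ T.erase i, y.1 k = 0 := fun i y hi hy k hk => by
      by_cases hki : k = i
      · rw [hki, hi]
      · exact hy k (hx k fun hkT => hk (Finset.mem_erase.2 ⟨hki, hkT⟩))
    have ha := exists_bound_face hh hC m (T.erase l) (by rw [Finset.card_erase_of_mem hlT]; omega)
      a (hsupp l a hal fun k hk => (h0 k hk).1)
    have hb := exists_bound_face hh hC m (T.erase j) (by rw [Finset.card_erase_of_mem hjT]; omega)
      b (hsupp j b hbj fun k hk => (h0 k hk).2)
    have := hh a b x hab
    push_cast
    linarith

theorem bounded_above_of_measurable {n : ℕ} {h : Simplex n → ℝ} (hh : ApproxConvex h)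
    (hm : Measurable h) : ∃ C, ∀ x, h x ≤ C := by
  choose B hB using exists_bound_edge hh hm
  obtain ⟨C, hC⟩ := (Set.finite_range fun p : Fin (n + 1) × Fin (n + 1) => B p.1 p.2).bddAbove
  refine ⟨C + n, fun x => exists_bound_face hh (fun i j x hx => (hB i j x hx).trans
    (hC ⟨(i, j), rfl⟩)) n Finset.univ (by simp) x (by simp)⟩

/-! ### The maximum of `E` -/

theorem hasSum_min_two_pow (n : ℕ) :
    HasSum (fun k => ((min n (2 ^ k) : ℕ) : ℝ) / 2 ^ k) (kappa n) := by
  by_cases hn : n = 0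
  · subst hn
    simp [kappa, hasSum_zero]
  rw [kappa, if_neg hn]
  -- The terms with `2^k ≤ n` equal 1; the remaining ones form a geometric series.
  refine (hasSum_nat_add_iff' (Nat.log 2 n + 1)).1 ?_
  have h1 : ∑ k ∈ Finset.range (Nat.log 2 n + 1), ((min n (2 ^ k) : ℕ) : ℝ) / 2 ^ k =
      Nat.log 2 n + 1 := by
    rw [Finset.sum_congr rfl (g := fun _ => (1 : ℝ)), Finset.sum_const, Finset.card_range]
    · simp
    · intro k hk
      have : 2 ^ k ≤ n := (Nat.pow_le_pow_right two_pos (by simpa [Nat.lt_succ_iff] using hk)).trans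
        (Nat.pow_log_le_self 2 hn)
      rw [min_eq_right this]
      push_cast
      exact div_self (by positivity)
  rw [h1, add_sub_cancel_left]
  refine (hasSum_geometric_two' ((n : ℝ) / 2 ^ Nat.log 2 n)).congr_fun fun k => ?_
  have : n ≤ 2 ^ (k + (Nat.log 2 n + 1)) := (Nat.lt_pow_succ_log_self one_lt_two n).le.trans
    (Nat.pow_le_pow_right two_pos (by omega))
  rw [min_eq_left this, pow_add, pow_add]
  field_simp

theorem E_le_kappa {n : ℕ} (x : Simplex n) : E n x ≤ kappa n :=
  hasSum_le (fun k => by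
    gcongr
    exact le_min (fractMass_le x k) (fractMass_le_two_pow x k)) (hasSum_E x) (hasSum_min_two_pow n)

theorem E_eq_kappa {n : ℕ} {x : Simplex n} (hx : ∀ k, fractMass x k = min n (2 ^ k)) :
    E n x = kappa n :=
  (hasSum_E x).unique (by simpa only [hx] using hasSum_min_two_pow n)

/-- Strict superlevel sets of a lower semicontinuous function are open. -/
theorem isGδ_setOf_E_eq_kappa (n : ℕ) : IsGδ {x : Simplex n | E n x = kappa n} := by
  have h : {x : Simplex n | E n x = kappa n} =
      ⋂ m : ℕ, E n ⁻¹' Set.Ioi (kappa n - 1 / ((m : ℝ) + 1)) := by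
    ext x
    simp only [Set.mem_ofPred_eq, Set.mem_iInter, Set.mem_preimage, Set.mem_Ioi]
    refine ⟨fun hx m => ?_, fun hx => le_antisymm (E_le_kappa x) (le_of_forall_pos_lt_add ?_)⟩
    · rw [hx, sub_lt_self_iff]
      positivity
    · intro ε hε
      obtain ⟨m, hm⟩ := exists_nat_one_div_lt hε
      linarith [hx m]
  rw [h]
  exact IsGδ.iInter_of_isOpen fun m => (lowerSemicontinuous_E n).isOpen_preimage _

/-! ### Maximizers from binary digits -/

/-- The number whose `k`-th binary digit after the point is `1` if and only if `c (j + k) = i`. -/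
noncomputable def digitTail {α : Type*} [DecidableEq α] (c : ℕ → α) (i : α) (j : ℕ) : ℝ :=
  ∑' k : ℕ, if c (j + k) = i then 1 / 2 / (2 : ℝ) ^ k else 0

section digitTail

variable {α : Type*} [DecidableEq α] (c : ℕ → α) (i : α)

theorem digit_nonneg (j k : ℕ) : 0 ≤ if c (j + k) = i then 1 / 2 / (2 : ℝ) ^ k else 0 := by
  split_ifs <;> positivity

theorem summable_digitTail (j : ℕ) :
    Summable fun k : ℕ => if c (j + k) = i then 1 / 2 / (2 : ℝ) ^ k else 0 :=
  (hasSum_geometric_two' 1).summable.of_nonneg_of_le (digit_nonneg c i j) fun k => by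
    split_ifs
    · rfl
    · positivity

theorem digitTail_eq (j : ℕ) :
    digitTail c i j = (if c j = i then 1 / 2 else 0) + digitTail c i (j + 1) / 2 := by
  unfold digitTail
  rw [(summable_digitTail c i j).tsum_eq_zero_add, ← tsum_div_const]
  congr 1
  · simp
  · refine tsum_congr fun k => ?_
    rw [show j + (k + 1) = j + 1 + k by ring, ite_div, zero_div, pow_succ, div_div _ _ (2 : ℝ)]

theorem digitTail_le_one (j : ℕ) : digitTail c i j ≤ 1 := by
  rw [← (hasSum_geometric_two' (1 : ℝ)).tsum_eq]
  refine (summable_digitTail c i j).tsum_le_tsum (fun k => ?_) (hasSum_geometric_two' 1).summable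
  split_ifs
  · rfl
  · positivity

theorem sum_digitTail [Fintype α] (j : ℕ) : ∑ i, digitTail c i j = 1 := by
  unfold digitTail
  rw [← Summable.tsum_finsetSum fun i _ => summable_digitTail c i j]
  exact (tsum_congr fun k => by simp).trans (hasSum_geometric_two' (1 : ℝ)).tsum_eq

theorem digitTail_pos {c : ℕ → α} {i : α} {j : ℕ} (h : ∃ k, c (j + k) = i) :
    0 < digitTail c i j := by
  obtain ⟨k, hk⟩ := h
  exact (summable_digitTail c i j).tsum_pos (digit_nonneg c i j) k (by rw [if_pos hk]; positivity)

theorem exists_two_pow_mul_digitTail : ∀ j : ℕ,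
    ∃ m : ℤ, 2 ^ j * digitTail c i 0 = m + digitTail c i j
  | 0 => ⟨0, by simp⟩
  | j + 1 => by
    obtain ⟨m, hm⟩ := exists_two_pow_mul_digitTail j
    refine ⟨2 * m + if c j = i then 1 else 0, ?_⟩
    rw [pow_succ', mul_assoc, hm, digitTail_eq]
    push_cast
    split_ifs <;> ring

/-- Recurrence makes every later tail positive, so the first digit can be read off without dyadic
ambiguity. -/
theorem half_lt_digitTail_iff {c : ℕ → α} (hc : ∀ i j, ∃ k, c (j + k) = i) (i : α) (j : ℕ) :
    1 / 2 < digitTail c i j ↔ c j = i := by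
  rw [digitTail_eq]
  have h0 := digitTail_pos (hc i (j + 1))
  have h1 := digitTail_le_one c i (j + 1)
  split_ifs with h
  · exact iff_of_true (by linarith) h
  · exact iff_of_false (by linarith) h

end digitTail

/-- Let `d_i` be the digit tails of `c`; they sum to 1 at every level. With `2^(L+1) x_i = m_i -
d_i`, the late fractional parts `1 - d_i` have sum `(n + 1) - 1 = n`. With `m_i ≤ 2`, the early `2^k
x_i` stay below 1 and have sum `2^k`. -/
theorem exists_maximizer {n : ℕ} (hn : n ≠ 0) {c : ℕ → Fin (n + 1)}
    (hc : ∀ i j, ∃ k, c (j + k) = i) :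
    ∃ x : Simplex n, E n x = kappa n ∧
      ∀ i j, Int.fract (2 ^ (Nat.log 2 n + 1 + j) * x.1 i) = 1 - digitTail c i j := by
  set L := Nat.log 2 n
  have hL : 2 ^ L ≤ n := Nat.pow_log_le_self 2 hn
  have hL' : n < 2 ^ (L + 1) := Nat.lt_pow_succ_log_self one_lt_two n
  -- The number of `m_i` equal to 2 is forced by `∑ m_i = 2^(L+1) + 1`, which gives `x` mass 1.
  obtain ⟨S, -, hS⟩ := Finset.exists_subset_card_eq
    (s := (Finset.univ : Finset (Fin (n + 1)))) (n := 2 ^ (L + 1) - n)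
    (by rw [Finset.card_univ, Fintype.card_fin, pow_succ]; omega)
  have hS' : (S.card : ℝ) = 2 ^ (L + 1) - n := by
    rw [hS, Nat.cast_sub hL'.le]
    push_cast
    rfl
  set m : Fin (n + 1) → ℤ := fun i => 1 + if i ∈ S then 1 else 0 with hm
  have hm1 : ∀ i, (1 : ℝ) ≤ m i := fun i => by simp only [hm]; split_ifs <;> norm_num
  have hm2 : ∀ i, (m i : ℝ) ≤ 2 := fun i => by simp only [hm]; split_ifs <;> norm_num
  have hmsum : ∑ i, (m i : ℝ) = 2 ^ (L + 1) + 1 := by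
    simp only [hm]
    push_cast
    rw [Finset.sum_add_distrib]
    simp [hS']
    ring
  have hpos : ∀ i j, 0 < digitTail c i j := fun i j => digitTail_pos (hc i j)
  have hle : ∀ i j, digitTail c i j ≤ 1 := fun i j => digitTail_le_one c i j
  let x : Simplex n := ⟨fun i => (m i - digitTail c i 0) / 2 ^ (L + 1),
    fun i => div_nonneg (by linarith [hm1 i, hle i 0]) (by positivity), by
      rw [← Finset.sum_div, Finset.sum_sub_distrib, hmsum, sum_digitTail, add_sub_cancel_right,
        div_self (by positivity)]⟩
  have hx : ∀ i, 2 ^ (L + 1) * x.1 i = m i - digitTail c i 0 := fun i =>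
    mul_div_cancel₀ _ (by positivity)
  have hfr : ∀ i j, Int.fract (2 ^ (L + 1 + j) * x.1 i) = 1 - digitTail c i j := fun i j => by
    obtain ⟨z, hz⟩ := exists_two_pow_mul_digitTail c i j
    rw [Int.fract_eq_iff]
    refine ⟨by linarith [hle i j], by linarith [hpos i j], 2 ^ j * m i - z - 1, ?_⟩
    rw [pow_add, mul_right_comm, hx, sub_mul, mul_comm _ ((2 : ℝ) ^ j), mul_comm _ ((2 : ℝ) ^ j), hz]
    push_cast
    ring
  refine ⟨x, E_eq_kappa fun k => ?_, hfr⟩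
  have hcast : (fractMass x k : ℝ) = ((min n (2 ^ k) : ℕ) : ℝ) := by
    rw [fractMass_eq]
    rcases le_or_gt k L with hk | hk
    · rw [min_eq_right ((Nat.pow_le_pow_right two_pos hk).trans hL)]
      have : ∀ i, Int.fract (2 ^ k * x.1 i) = 2 ^ k * x.1 i := fun i => by
        have h0 := simplex_nonneg x i
        refine Int.fract_eq_self.2 ⟨by positivity, ?_⟩
        have h1 : (2 : ℝ) ^ k * x.1 i ≤ 2 ^ L * x.1 i := by
          gcongr
          norm_num
        have h2 := hx i
        rw [pow_succ', mul_assoc] at h2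
        linarith [hm2 i, hpos i 0]
      rw [Finset.sum_congr rfl fun i _ => this i, ← Finset.mul_sum, simplex_sum]
      simp
    · obtain ⟨j, rfl⟩ := Nat.exists_eq_add_of_le (Nat.succ_le_of_lt hk)
      rw [min_eq_left (hL'.le.trans (Nat.pow_le_pow_right two_pos (by omega))),
        Finset.sum_congr rfl fun i _ => hfr i j, Finset.sum_sub_distrib, sum_digitTail]
      simp
  exact_mod_cast hcast

/-- A sequence that takes every value infinitely often and encodes `s` along an arithmetic
progression. -/
def recurrentCode (n : ℕ) (s : ℕ → Bool) (k : ℕ) : Fin (n + 1) :=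
  if h : k % (n + 2) < n + 1 then ⟨k % (n + 2), h⟩
  else if s (k / (n + 2)) then 0 else Fin.last n

theorem recurrentCode_recurrent (n : ℕ) (s : ℕ → Bool) (i : Fin (n + 1)) (j : ℕ) :
    ∃ k, recurrentCode n s (j + k) = i := by
  refine ⟨j * (n + 1) + i, ?_⟩
  have hmod : (j + (j * (n + 1) + i)) % (n + 2) = i := by
    rw [show j + (j * (n + 1) + i) = i + (n + 2) * j by ring, Nat.add_mul_mod_self_left]
    exact Nat.mod_eq_of_lt (by omega)
  rw [recurrentCode, dif_pos (by rw [hmod]; exact i.2)]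
  exact Fin.ext hmod

/-- The residue `n + 1` modulo `n + 2` carries the bits of `s`; `n ≠ 0` keeps the two marks `0` and
`Fin.last n` distinct. -/
theorem recurrentCode_marker {n : ℕ} (hn : n ≠ 0) (s : ℕ → Bool) (l : ℕ) :
    recurrentCode n s ((n + 1) + (n + 2) * l) = 0 ↔ s l = true := by
  have hmod : ((n + 1) + (n + 2) * l) % (n + 2) = n + 1 := by
    rw [Nat.add_mul_mod_self_left]
    exact Nat.mod_eq_of_lt (by omega)
  have hdiv : ((n + 1) + (n + 2) * l) / (n + 2) = l := by
    rw [Nat.add_mul_div_left _ _ (by omega), Nat.div_eq_of_lt (by omega), zero_add]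
  rw [recurrentCode, dif_neg (by omega), hdiv]
  split_ifs with h
  · simp [h]
  · simp only [h]
    refine iff_of_false (fun h0 => hn ?_) (by simp)
    simpa using congrArg Fin.val h0

theorem not_countable_nat_to_bool : ¬ Countable (ℕ → Bool) := fun h => by
  obtain ⟨f, hf⟩ := exists_surjective_nat (ℕ → Bool)
  obtain ⟨k, hk⟩ := hf fun k => !f k k
  simpa using congrFun hk k

theorem not_countable_setOf_E_eq_kappa {n : ℕ} (hn : n ≠ 0) :
    ¬ {x : Simplex n | E n x = kappa n}.Countable := by
  intro hcount
  choose X hX hfr using fun s : ℕ → Bool =>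
    exists_maximizer hn (recurrentCode_recurrent n s)
  have hinj : Function.Injective X := fun s t hst => by
    have htail : ∀ i j, digitTail (recurrentCode n s) i j = digitTail (recurrentCode n t) i j :=
      fun i j => by
        have h1 := hfr s i j
        rw [hst, hfr t i j] at h1
        linarith
    funext l
    rw [Bool.eq_iff_iff, ← recurrentCode_marker hn, ← recurrentCode_marker hn,
      ← half_lt_digitTail_iff (recurrentCode_recurrent n s),
      ← half_lt_digitTail_iff (recurrentCode_recurrent n t), htail]
  have : Countable {x : Simplex n | E n x = kappa n} := hcount.to_subtype
  exact not_countable_nat_to_bool (Function.Injective.countable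
    (f := fun s => (⟨X s, hX s⟩ : {x : Simplex n | E n x = kappa n}))
    fun s t hst => hinj (congrArg Subtype.val hst))

theorem exists_E_eq_kappa (n : ℕ) : ∃ x : Simplex n, E n x = kappa n := by
  by_cases hn : n = 0
  · subst hn
    exact ⟨stdSimplex.vertex 0, by simp [E_vertex, kappa]⟩
  · obtain ⟨x, hx, -⟩ := exists_maximizer hn (recurrentCode_recurrent n fun _ => true)
    exact ⟨x, hx⟩

theorem le_E_of_boundedFun_or_measurable {n : ℕ} {h : Simplex n → ℝ} (hh : ApproxConvex h)
    (hbm : BoundedFun h ∨ Measurable h) (hv : ∀ k, h (stdSimplex.vertex k) ≤ 0) (x : Simplex n) :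
    h x ≤ E n x := by
  obtain ⟨C, hC⟩ : ∃ C, ∀ y, h y ≤ C := by
    rcases hbm with ⟨C, hC⟩ | hm
    · exact ⟨C, fun y => (le_abs_self _).trans (hC y)⟩
    · exact bounded_above_of_measurable hh hm
  exact le_E_of_bounded_above hh hv hC x

theorem theorem1p2 (n : ℕ) :
    ApproxConvex (E n) ∧
    BoundedFun (E n) ∧
    LowerSemicontinuous (E n) ∧
    (∀ k : Fin (n + 1), E n (stdSimplex.vertex k) = 0) ∧
    -- the extremal property
    DominatesBounded n (E n) ∧
    DominatesBorel n (E n) ∧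
    -- the extremal property (for either class of functions) characterizes `E`
    (∀ F : Simplex n → ℝ, ApproxConvex F → (BoundedFun F ∨ Measurable F) →
      (∀ k : Fin (n + 1), F (stdSimplex.vertex k) ≤ 0) →
      (DominatesBounded n F ∨ DominatesBorel n F) → F = E n) ∧
    -- the maximum of `E` and the set where it is attained
    IsGreatest (Set.range (E n)) (kappa n) ∧
    IsGδ {x : Simplex n | E n x = kappa n} ∧
    (1 ≤ n → ¬ {x : Simplex n | E n x = kappa n}.Countable) := by

  have hvE : ∀ k : Fin (n + 1), E n (stdSimplex.vertex k) ≤ 0 := fun k => (E_vertex n k).le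
  refine ⟨approxConvex_E n, boundedFun_E n, lowerSemicontinuous_E n, E_vertex n,
    fun h hb hh hv => le_E_of_boundedFun_or_measurable hh (Or.inl hb) hv,
    fun h hm hh hv => le_E_of_boundedFun_or_measurable hh (Or.inr hm) hv,
    fun F hF hbm hv hdom => funext fun x =>
      le_antisymm (le_E_of_boundedFun_or_measurable hF hbm hv x) ?_,
    ⟨exists_E_eq_kappa n, ?_⟩, isGδ_setOf_E_eq_kappa n,
    fun hn => not_countable_setOf_E_eq_kappa (Nat.one_le_iff_ne_zero.1 hn)⟩
  · rcases hdom with hdom | hdom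
    · exact hdom (E n) (boundedFun_E n) (approxConvex_E n) hvE x
    · exact hdom (E n) (lowerSemicontinuous_E n).measurable (approxConvex_E n) hvE x
  · rintro _ ⟨x, rfl⟩
    exact E_le_kappa x
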